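/- Let $d\ge 2$ and let $\sigma$ be the uniform probability measure on the sphere $\mathbb S^{d-1}\subset\mathbb R^d$. Let $W:\mathbb S^{d-1}\times\mathbb S^{d-1}\to[0,1]$ be a geometric graphon, that is, a measurable symmetric function of the form $W(x,y)=f(\langle x,y\rangle)$ with $f:[-1,1]\to[0,1]$, and let $T_Wg(x)=\int g(y)W(x,y)\,d\sigma(y)$ be its integral operator on $L^2(\sigma)$. The eigenfunctions of $T_W$ are the spherical harmonics. Let $d_k$ be the dimension of the space of spherical harmonics of degree $k$ (so $d_0=1$, $d_1=d$), and let $\lambda(T_W)=(\lambda^\ast_0,\lambda^\ast_1,\dots)$ be the eigenvalues of $T_W$ with multiplicity, enumerated by degree: $\lambda_j^\ast$ is the eigenvalue of $T_W$ on the spherical harmonics of degree $k$ whenever $d_0+\dots+d_{k-1}\le j<d_0+\dots+d_k$. Assume that $$\Delta^\ast:=\operatorname{Gap}_1(W):=\inf_{j\notin\{1,\dots,d_1\}}|\lambda^\ast_1-\lambda^\ast_j|>0 .$$ Let $n$ be a natural number and $0<\rho_n\le 1$. For latent points $X_1,\dots,X_n\in\mathbb S^{d-1}$ put $T_n=\big(\tfrac1n\rho_nW(X_i,X_j)\big)_{i,j}$,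 and let $\hat T_n$ be the observed normalised adjacency matrix, a symmetric $n\times n$ matrix such that $n\hat T_n$ has entries in $\{0,1\}$. For real sequences put $\delta_2(x,y)=\inf_p\big(\sum_i(x_i-y_{p(i)})^2\big)^{1/2}$, where $p$ ranges over the permutations of $\mathbb N=\{0,1,2,\dots\}$; finite spectra are completed by zeros. Let $\mathcal E$ be the event $$\mathcal E=\Big\{\max\Big(\delta_2\big(\lambda(\tfrac1{\rho_n}T_n),\lambda(T_W)\big),\ \frac{2^{9/2}\sqrt d}{\rho_n\Delta^\ast}\|T_n-\hat T_n\|_{op}\Big)\le\frac{\Delta^\ast}4\Big\}.$$ Let $\hat\lambda_0\ge\hat\lambda_1\ge\dots\ge\hat\lambda_{n-1}$ be the eigenvalues of $\hat T_n$ in decreasing order, with multiplicity, and define $$\operatorname{Gap}_1(\hat T_n)=\max_{S}\ \min_{i\in\{0,\dots,n-1\}\setminus S}\ \min_{j\in S}|\hat\lambda_j-\hat\lambda_i| ,$$ where $S$ ranges over the subsets of $\{1,\dots,n-1\}$ of size $d$. Let $\mathrm{left}(i)=|\hat\lambda_i-\hat\lambda_{i-1}|$ for $1\le i\le n-1$ and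 $\mathrm{right}(i)=\mathrm{left}(i+1)$ for $0\le i\le n-2$. Then for every outcome $(X_1,\dots,X_n,\hat T_n)$ in the event $\mathcal E$ one has $n>d$ and $$\operatorname{Gap}_1(\hat T_n)=\max\Big\{\max_{1\le i\le n-d-1}\min\{\mathrm{left}(i),\mathrm{right}(i+d-1)\},\ \mathrm{left}(n-d)\Big\},$$ where the inner maximum is omitted if $n=d+1$. -/

import Mathlib

open MeasureTheory
open scoped ENNReal

namespace HEiC

/-- The unit sphere `S^{d-1}` of `ℝ^d`. -/
abbrev Sph (d : ℕ) : Type := Metric.sphere (0 : EuclideanSpace ℝ (Fin d)) 1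

/-- The uniform probability measure on `S^{d-1}` (normalised surface measure). -/
noncomputable def sigma (d : ℕ) : Measure (Sph d) :=
  ((volume : Measure (EuclideanSpace ℝ (Fin d))).toSphere Set.univ)⁻¹ •
    (volume : Measure (EuclideanSpace ℝ (Fin d))).toSphere

/-- A graphon on the sphere: a symmetric measurable function `W : S^{d-1} × S^{d-1} → [0,1]`. -/
structure SphereGraphon (d : ℕ) where
  toFun : Sph d → Sph d → ℝ
  measurable_uncurry : Measurable (fun p : Sph d × Sph d => toFun p.1 p.2)
  symmetric : ∀ x y, toFun x y = toFun y x
  mem_Icc : ∀ x y, toFun x y ∈ Set.Icc (0 : ℝ) 1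

/-- `W` is geometric: `W(x,y) = f(⟨x,y⟩)` for some `f : [-1,1] → [0,1]`. -/
def SphereGraphon.IsGeometric {d : ℕ} (W : SphereGraphon d) : Prop :=
  ∃ f : ℝ → ℝ, (∀ t ∈ Set.Icc (-1 : ℝ) 1, f t ∈ Set.Icc (0 : ℝ) 1) ∧
    ∀ x y : Sph d,
      W.toFun x y = f (inner ℝ (x : EuclideanSpace ℝ (Fin d)) (y : EuclideanSpace ℝ (Fin d)))

/-- The integral operator `T_W g (x) = ∫ g(y) W(x,y) dσ(y)`. -/
noncomputable def integralOp {d : ℕ} (W : SphereGraphon d) (g : Sph d → ℝ) : Sph d → ℝ :=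
  fun x => ∫ y, g y * W.toFun x y ∂(sigma d)

/-- The Laplacian `∑ᵢ ∂ᵢ²` on polynomials in `d` variables. -/
noncomputable def laplacian (d : ℕ) : MvPolynomial (Fin d) ℝ →ₗ[ℝ] MvPolynomial (Fin d) ℝ :=
  ∑ i : Fin d, (MvPolynomial.pderiv (R := ℝ) i).toLinearMap ∘ₗ
    (MvPolynomial.pderiv (R := ℝ) i).toLinearMap

/-- The space of harmonic polynomials in `d` variables that are homogeneous of degree `k`;
the spherical harmonics of degree `k` are their restrictions to the sphere. -/
noncomputable def harmonicSpace (d k : ℕ) : Submodule ℝ (MvPolynomial (Fin d) ℝ) :=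
  MvPolynomial.homogeneousSubmodule (Fin d) ℝ k ⊓ LinearMap.ker (laplacian d)

/-- Restriction of a polynomial to the sphere. -/
noncomputable def restrictSph {d : ℕ} (Y : MvPolynomial (Fin d) ℝ) : Sph d → ℝ :=
  fun x => MvPolynomial.eval (fun i => (x : EuclideanSpace ℝ (Fin d)) i) Y

/-- `d_k`, the dimension of the space of spherical harmonics of degree `k` (a homogeneous
polynomial is determined by its restriction to the sphere). -/
noncomputable def harmonicDim (d k : ℕ) : ℕ := Module.finrank ℝ (harmonicSpace d k)

/-- `μ` is the eigenvalue of `T_W` on the spherical harmonics of degree `k`. -/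
def IsHarmonicEigenvalue {d : ℕ} (W : SphereGraphon d) (k : ℕ) (μ : ℝ) : Prop :=
  ∀ Y ∈ harmonicSpace d k,
    integralOp W (restrictSph Y) =ᵐ[sigma d] fun x => μ * restrictSph Y x

open Classical in
/-- The eigenvalue of `T_W` on the spherical harmonics of degree `k`. For a geometric graphon
and `2 ≤ d` there is exactly one such number, so the default value is never used. -/
noncomputable def harmonicEigenvalue {d : ℕ} (W : SphereGraphon d) (k : ℕ) : ℝ :=
  if h : ∃ μ : ℝ, IsHarmonicEigenvalue W k μ then h.choose else 0

/-- In the enumeration of an eigenbasis of spherical harmonics in which the harmonics of degree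
`0` come first, followed by those of degree `1`, and so on, the degree of the `j`-th one: the
unique `k` with `d_0 + ⋯ + d_{k-1} ≤ j < d_0 + ⋯ + d_k`. -/
noncomputable def harmonicDegree (d j : ℕ) : ℕ :=
  sInf {k : ℕ | j < ∑ l ∈ Finset.range (k + 1), harmonicDim d l}

/-- The spectrum `λ(T_W) = (λ*_0, λ*_1, …)` of `T_W`, with multiplicities, enumerated along
spherical harmonics of increasing degree: `λ*_0` belongs to the constants, `λ*_1, …, λ*_d` to the
linear functions, and so on. -/
noncomputable def graphonSpectrum {d : ℕ} (W : SphereGraphon d) (j : ℕ) : ℝ :=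
  harmonicEigenvalue W (harmonicDegree d j)

/-- The spectral gap `Gap₁(W)`, the distance from `λ*_1` to the `λ*_j`, `j ∉ {1, …, d_1}`. -/
noncomputable def graphonGap {d : ℕ} (W : SphereGraphon d) : ℝ :=
  ⨅ j : {j : ℕ // j ∉ Finset.Icc 1 (harmonicDim d 1)},
    |graphonSpectrum W 1 - graphonSpectrum W j|

open Classical in
/-- The eigenvalues of a real symmetric `n × n` matrix, with multiplicities, in decreasing order,
as a sequence `λ_0 ≥ λ_1 ≥ ⋯ ≥ λ_{n-1}` which is then completed with zeros. -/
noncomputable def sortedSpectrum {n : ℕ} (A : Matrix (Fin n) (Fin n) ℝ) (i : ℕ) : ℝ :=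
  if h : A.IsHermitian ∧ i < n then
    h.1.eigenvalues₀ ⟨i, by rw [Fintype.card_fin]; exact h.2⟩
  else 0

/-- The metric `δ₂(x,y) = inf_p (∑ᵢ (xᵢ - y_{p(i)})²)^{1/2}` over all permutations `p` of `ℕ`,
with values in `[0,∞]`. -/
noncomputable def deltaTwo (x y : ℕ → ℝ) : ℝ≥0∞ :=
  ⨅ p : Equiv.Perm ℕ, (∑' i, ENNReal.ofReal ((x i - y (p i)) ^ 2)) ^ (1 / 2 : ℝ)

/-- The normalised probability matrix `T_n = Θ / n`, where `Θ_{ij} = ρ W(X_i, X_j)`. -/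
noncomputable def probMatrix {d n : ℕ} (W : SphereGraphon d) (ρ : ℝ) (X : Fin n → Sph d) :
    Matrix (Fin n) (Fin n) ℝ :=
  Matrix.of fun i j => (n : ℝ)⁻¹ * (ρ * W.toFun (X i) (X j))

/-- The operator norm of a matrix for the Euclidean norm. -/
noncomputable def matOpNorm {n : ℕ} (A : Matrix (Fin n) (Fin n) ℝ) : ℝ :=
  ‖Matrix.toEuclideanCLM (n := Fin n) (𝕜 := ℝ) A‖

/-- The possible outcomes of the `W`-random graph model with `n` nodes: the latent points
`X_1, …, X_n` on the sphere, and a symmetric matrix `T̂_n` such that `n T̂_n` has entries in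
`{0,1}`. -/
structure Outcome (d n : ℕ) where
  X : Fin n → Sph d
  That : Matrix (Fin n) (Fin n) ℝ
  symm : That.IsSymm
  zero_or_one : ∀ i j, (n : ℝ) * That i j = 0 ∨ (n : ℝ) * That i j = 1

/-- The event
`δ₂(λ(T_n / ρ), λ(T_W)) ∨ (2^{9/2} √d / (ρ Δ*)) ‖T_n - T̂_n‖_op ≤ Δ* / 4`, with `Δ* = Gap₁(W)`. -/
noncomputable def goodEvent {d : ℕ} (W : SphereGraphon d) (n : ℕ) (ρ : ℝ) : Set (Outcome d n) :=
  {ω | deltaTwo (sortedSpectrum (ρ⁻¹ • probMatrix W ρ ω.X)) (graphonSpectrum W) ≤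
        ENNReal.ofReal (graphonGap W / 4) ∧
      (2 : ℝ) ^ (9 / 2 : ℝ) * √(d : ℝ) / (ρ * graphonGap W) *
        matOpNorm (probMatrix W ρ ω.X - ω.That) ≤ graphonGap W / 4}

/-- For a set `S` of indices, the distance `min_{i ∉ S} min_{j ∈ S} |λ_j - λ_i|`,
where `i` ranges over `{0, …, n-1} \ S`. -/
noncomputable def subsetGap (lam : ℕ → ℝ) (n : ℕ) (S : Finset ℕ) : ℝ :=
  ⨅ i : ↥(Finset.range n \ S), ⨅ j : ↥S, |lam j - lam i|

/-- The empirical gap `Gap₁(T̂)` : the maximum of `min_{i ∉ S} min_{j ∈ S} |λ̂_j - λ̂_i|` over all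
subsets `S` of `{1, …, n-1}` of size `d`, where `λ̂_0 ≥ ⋯ ≥ λ̂_{n-1}` are the eigenvalues of `T̂`. -/
noncomputable def empiricalGap {n : ℕ} (d : ℕ) (That : Matrix (Fin n) (Fin n) ℝ) : ℝ :=
  ⨆ S : ↥((Finset.Icc 1 (n - 1)).powersetCard d), subsetGap (sortedSpectrum That) n S

/-- `left(i) = |λ̂_i - λ̂_{i-1}|`, used for `1 ≤ i ≤ n-1`. -/
noncomputable def left {n : ℕ} (That : Matrix (Fin n) (Fin n) ℝ) (i : ℕ) : ℝ :=
  |sortedSpectrum That i - sortedSpectrum That (i - 1)|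

/-- `right(i) = left(i+1)`, used for `0 ≤ i ≤ n-2`. -/
noncomputable def right {n : ℕ} (That : Matrix (Fin n) (Fin n) ℝ) (i : ℕ) : ℝ :=
  left That (i + 1)

/-- The result of the scan over the windows `{i, …, i+d-1}` of consecutive indices in
`{1, …, n-1}`. For `n = d + 1` the inner maximum is over the empty set and equals `0`; as `left`
is nonnegative, this means that it is omitted. -/
noncomputable def windowGap {n : ℕ} (d : ℕ) (That : Matrix (Fin n) (Fin n) ℝ) : ℝ :=
  max (⨆ i : ↥(Finset.Icc 1 (n - d - 1)), min (left That i) (right That (i + d - 1)))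
    (left That (n - d))

end HEiC

/-! Write `x`, `y`, `lam` for the spectra of T_n/ρ, T_W and T̂_n. Windows are admissible subsets, so
the scan never exceeds the empirical gap; the content is that no other subset does better.

On the event a permutation `p` matches `x` to `y` with ℓ² error just above Δ/4, and Weyl's
inequality puts `lam` within ρΔ/90 of ρ`x`. The set `A` of indices matched to {1, …, d} then has gap
greater than 0.55ρΔ. A competitor `S` with such a gap contains every index whose `x`-value is within
0.52Δ of one of its own. Apart from `y 0`, each graphon eigenvalue repeats at least d times. If some
block represented in `S` is matched entirely below n, then `S` absorbs it and, having d elements,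
equals its preimage. Otherwise every block met by `S` is partly matched to the zero tail, so its
value is small. In both cases the `x`-values on `S` spread by at most 0.52Δ. Since `lam` is
monotone, indices between elements of `S` also belong to `S`, so `S` is a window. This is
`iSup_subsetGap_eq_windowScan`.

Its spectral inputs are `le_harmonicDim` (every degree k ≥ 1 has multiplicity at least d) and
`abs_harmonicEigenvalue_le` (the constants carry the eigenvalue of largest modulus). -/

namespace HEiC

/-! ### Subset gaps and windows of a sequence -/

/-- The scan over windows of `d` consecutive indices in `{1, …, n-1}` for a general sequence. -/
noncomputable def windowScan (lam : ℕ → ℝ) (n d : ℕ) : ℝ :=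
  max (⨆ i : ↥(Finset.Icc 1 (n - d - 1)),
      min |lam i - lam (i - 1)| |lam (i + d - 1 + 1) - lam (i + d - 1 + 1 - 1)|)
    |lam (n - d) - lam (n - d - 1)|

lemma subsetGap_le {lam : ℕ → ℝ} {n : ℕ} {S : Finset ℕ} {i j : ℕ} (hi : i < n) (hiS : i ∉ S)
    (hj : j ∈ S) : subsetGap lam n S ≤ |lam j - lam i| :=
  (ciInf_le (Set.finite_range _).bddBelow
    (⟨i, by simp [hi, hiS]⟩ : ↥(Finset.range n \ S))).trans
    (ciInf_le (Set.finite_range _).bddBelow (⟨j, hj⟩ : ↥S))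

lemma le_subsetGap {lam : ℕ → ℝ} {n : ℕ} {S : Finset ℕ} {c : ℝ} (hS : S.Nonempty)
    (hS' : (Finset.range n \ S).Nonempty)
    (h : ∀ i < n, i ∉ S → ∀ j ∈ S, c ≤ |lam j - lam i|) : c ≤ subsetGap lam n S := by
  have := hS.to_subtype
  have := hS'.to_subtype
  refine le_ciInf fun i => le_ciInf fun j => ?_
  have hi := Finset.mem_sdiff.1 i.2
  exact h i (Finset.mem_range.1 hi.1) hi.2 j j.2

lemma subsetGap_nonneg (lam : ℕ → ℝ) (n : ℕ) (S : Finset ℕ) : 0 ≤ subsetGap lam n S :=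
  Real.iInf_nonneg fun _ => Real.iInf_nonneg fun _ => abs_nonneg _

lemma subsetGap_Ico_le_windowScan (lam : ℕ → ℝ) {n d i : ℕ} (hd : 1 ≤ d) (hi : 1 ≤ i)
    (hin : i + d ≤ n) : subsetGap lam n (Finset.Ico i (i + d)) ≤ windowScan lam n d := by
  have hleft : subsetGap lam n (Finset.Ico i (i + d)) ≤ |lam i - lam (i - 1)| :=
    subsetGap_le (by omega) (by simp; omega) (by simp; omega)
  rcases hin.eq_or_lt with h | h
  · obtain rfl : i = n - d := by omega
    exact hleft.trans (le_max_right _ _)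
  · refine le_trans ?_ (le_max_left _ _)
    refine le_trans (le_min hleft ?_) (le_ciSup (f := fun i : ↥(Finset.Icc 1 (n - d - 1)) =>
      min |lam i - lam (i - 1)| |lam (i + d - 1 + 1) - lam (i + d - 1 + 1 - 1)|)
      (Set.finite_range _).bddAbove ⟨i, Finset.mem_Icc.2 ⟨hi, by omega⟩⟩)
    simp only []
    rw [abs_sub_comm, show i + d - 1 + 1 - 1 = i + d - 1 by omega]
    exact subsetGap_le (by omega) (by simp; omega) (by simp; omega)

/-- By monotonicity only the neighbours i-1 and i+d of the window matter; the right one is missing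
when i+d = n, whence the conditional `hright`. -/
lemma min_le_subsetGap_Ico {lam : ℕ → ℝ} {n d i : ℕ} {c : ℝ} (hd : 1 ≤ d) (hi : 1 ≤ i)
    (hin : i + d ≤ n) (hanti : ∀ a b, a ≤ b → b < n → lam b ≤ lam a)
    (hleft : c ≤ |lam i - lam (i - 1)|)
    (hright : i + d < n → c ≤ |lam (i + d - 1 + 1) - lam (i + d - 1 + 1 - 1)|) :
    c ≤ subsetGap lam n (Finset.Ico i (i + d)) := by
  refine le_subsetGap ⟨i, by simp; omega⟩ ⟨0, by simp; omega⟩ fun m hm hmS j hj => ?_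
  rw [Finset.mem_Ico] at hmS hj
  rcases lt_or_ge m i with h | h
  · have h1 := hanti m (i - 1) (by omega) (by omega)
    have h2 := hanti (i - 1) i (by omega) (by omega)
    have h3 := hanti i j (by omega) (by omega)
    rw [abs_of_nonpos (by linarith)] at hleft ⊢
    linarith
  · have h0 := hright (by omega)
    rw [show i + d - 1 + 1 = i + d by omega] at h0
    have h1 := hanti (i + d) m (by omega) (by omega)
    have h2 := hanti (i + d - 1) (i + d) (by omega) (by omega)
    have h3 := hanti j (i + d - 1) (by omega) (by omega)
    rw [abs_of_nonpos (by linarith)] at h0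
    rw [abs_of_nonneg (by linarith)]
    linarith

lemma subsetGap_le_iSup (lam : ℕ → ℝ) {n d : ℕ} {S : Finset ℕ}
    (hS : S ∈ (Finset.Icc 1 (n - 1)).powersetCard d) :
    subsetGap lam n S ≤
      ⨆ S : ↥((Finset.Icc 1 (n - 1)).powersetCard d), subsetGap lam n S :=
  le_ciSup (f := fun S : ↥((Finset.Icc 1 (n - 1)).powersetCard d) => subsetGap lam n S)
    (Set.finite_range _).bddAbove ⟨S, hS⟩

lemma windowScan_le_iSup_subsetGap {lam : ℕ → ℝ} {n d : ℕ} (hd : 1 ≤ d) (hdn : d < n)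
    (hanti : ∀ a b, a ≤ b → b < n → lam b ≤ lam a) :
    windowScan lam n d ≤
      ⨆ S : ↥((Finset.Icc 1 (n - 1)).powersetCard d), subsetGap lam n S := by
  have hmem : ∀ i, 1 ≤ i → i + d ≤ n →
      Finset.Ico i (i + d) ∈ (Finset.Icc 1 (n - 1)).powersetCard d := by
    intro i hi hin
    rw [Finset.mem_powersetCard]
    refine ⟨fun m hm => ?_, by simp⟩
    simp only [Finset.mem_Ico, Finset.mem_Icc] at hm ⊢
    omega
  -- If n = d+1 the supremum is over an empty type and equals 0, so nonnegativity of the bound is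
  -- needed.
  refine max_le (Real.iSup_le ?_ (Real.iSup_nonneg fun _ => subsetGap_nonneg _ _ _)) ?_
  · rintro ⟨i, hi⟩
    rw [Finset.mem_Icc] at hi
    exact (min_le_subsetGap_Ico hd hi.1 (by omega) hanti (min_le_left _ _)
      fun _ => min_le_right _ _).trans (subsetGap_le_iSup lam (hmem i hi.1 (by omega)))
  · exact (min_le_subsetGap_Ico hd (by omega) (by omega) hanti le_rfl
      fun h => by omega).trans (subsetGap_le_iSup lam (hmem (n - d) (by omega) (by omega)))

lemma exists_eq_Ico_of_ordConnected {S : Finset ℕ} {n d : ℕ} (hd : 1 ≤ d)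
    (hS : S ∈ (Finset.Icc 1 (n - 1)).powersetCard d)
    (h : ∀ a ∈ S, ∀ c ∈ S, ∀ b, a ≤ b → b ≤ c → b ∈ S) :
    ∃ i, 1 ≤ i ∧ i + d ≤ n ∧ S = Finset.Ico i (i + d) := by
  obtain ⟨hsub, hcard⟩ := Finset.mem_powersetCard.1 hS
  have hne : S.Nonempty := Finset.card_pos.1 (by omega)
  have hmin := Finset.mem_Icc.1 (hsub (S.min'_mem hne))
  have hmax := Finset.mem_Icc.1 (hsub (S.max'_mem hne))
  have hle : S.min' hne ≤ S.max' hne := S.min'_le _ (S.max'_mem hne)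
  have hIcc : S = Finset.Ico (S.min' hne) (S.max' hne + 1) := by
    ext b
    rw [Finset.mem_Ico]
    exact ⟨fun hb => ⟨S.min'_le _ hb, Nat.lt_succ_of_le (S.le_max' _ hb)⟩, fun hb =>
      h _ (S.min'_mem hne) _ (S.max'_mem hne) b hb.1 (Nat.le_of_lt_succ hb.2)⟩
  have hc : S.max' hne + 1 - S.min' hne = d := by
    rw [← hcard]
    conv_rhs => rw [hIcc]
    simp
  refine ⟨S.min' hne, hmin.1, by omega, ?_⟩
  conv_lhs => rw [hIcc]
  congr 1
  omega

/-! ### The perturbation argument for matched sequences -/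

section Matching

variable {x y lam : ℕ → ℝ} {n d : ℕ} {Δ ρ : ℝ} {p : Equiv.Perm ℕ}

/-- Cauchy–Schwarz with 71/50 > √2; then 71/50 · 13/50 < 37/100 bounds two matching errors together.
-/
lemma abs_sum_le_of_sq {r a b : ℝ} (hr : 0 ≤ r) (h : a ^ 2 + b ^ 2 ≤ r ^ 2) :
    |a| + |b| ≤ 71 / 50 * r := by
  refine abs_le_of_sq_le_sq' ?_ (by positivity) |>.2
  nlinarith [sq_abs a, sq_abs b, sq_nonneg (|a| - |b|), sq_nonneg r]

lemma abs_sum_four_le_of_sq {r a b c e : ℝ} (hr : 0 ≤ r)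
    (h : a ^ 2 + b ^ 2 + c ^ 2 + e ^ 2 ≤ r ^ 2) :
    |a| + |b| + |c| + |e| ≤ 2 * r := by
  refine abs_le_of_sq_le_sq' ?_ (by positivity) |>.2
  nlinarith [sq_abs a, sq_abs b, sq_abs c, sq_abs e, sq_nonneg (|a| - |b|),
    sq_nonneg (|a| - |c|), sq_nonneg (|a| - |e|), sq_nonneg (|b| - |c|), sq_nonneg (|b| - |e|),
    sq_nonneg (|c| - |e|)]

/-- The value of the separated block is not small. -/
lemma le_abs_of_matching (hΔ : 0 ≤ Δ) (hx0 : ∀ i, n ≤ i → x i = 0)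
    (hmatch : ∀ F : Finset ℕ, ∑ i ∈ F, (x i - y (p i)) ^ 2 ≤ (13 / 50 * Δ) ^ 2)
    (hgap : ∀ j ∉ Finset.Icc 1 d, Δ ≤ |y 1 - y j|) : 37 / 50 * Δ ≤ |y 1| := by
  -- An index in the zero tail matched outside the block: its partner has modulus at most 0.26Δ, yet
  -- lies Δ away from `y 1`.
  obtain ⟨i, hi⟩ := Infinite.exists_notMem_finset
    (Finset.range n ∪ (Finset.Icc 1 d).map p.symm.toEmbedding)
  simp only [Finset.mem_union, Finset.mem_range, Finset.mem_map_equiv, Equiv.symm_symm,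
    not_or, not_lt] at hi
  have a : |x i - y (p i)| ≤ 13 / 50 * Δ :=
    abs_le_of_sq_le_sq (by simpa using hmatch {i}) (by positivity)
  have b := hgap _ hi.2
  rw [hx0 i hi.1, zero_sub, abs_neg] at a
  have c := abs_sub (y 1) (y (p i))
  linarith

/-- A perturbation result: if, up to a matching `p`, a decreasing sequence `x` is `ℓ²`-close to a
sequence `y` whose values come in blocks of size at least `d` (apart from the largest value `y 0`),
with one block of size exactly `d` that is separated by `Δ`, and `lam` is close to `ρ x`, then the
best subset of `d` indices is an interval. -/
theorem iSup_subsetGap_eq_windowScan (hd : 1 ≤ d) (hΔ : 0 < Δ) (hρ : 0 < ρ)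
    (hx0 : ∀ i, n ≤ i → x i = 0) (hx : ∀ a b, a ≤ b → b < n → x b ≤ x a)
    (hlam : ∀ a b, a ≤ b → b < n → lam b ≤ lam a)
    (hclose : ∀ i < n, |lam i - ρ * x i| ≤ ρ * (Δ / 90))
    (hmatch : ∀ F : Finset ℕ, ∑ i ∈ F, (x i - y (p i)) ^ 2 ≤ (13 / 50 * Δ) ^ 2)
    (hy1 : ∀ j ∈ Finset.Icc 1 d, y j = y 1) (hgap : ∀ j ∉ Finset.Icc 1 d, Δ ≤ |y 1 - y j|)
    (hy0 : ∀ j, |y j| ≤ y 0)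
    (hblock : ∀ j, 1 ≤ j → ∃ B : Finset ℕ, j ∈ B ∧ d ≤ B.card ∧ ∀ b ∈ B, y b = y j) :
    d < n ∧ (⨆ S : ↥((Finset.Icc 1 (n - 1)).powersetCard d), subsetGap lam n S) =
      windowScan lam n d := by
  have hr : 0 ≤ 13 / 50 * Δ := by positivity
  have h1 : ∀ i, |x i - y (p i)| ≤ 13 / 50 * Δ := fun i =>
    abs_le_of_sq_le_sq (by simpa using hmatch {i}) hr
  have h2 : ∀ i j, i ≠ j → |x i - y (p i)| + |x j - y (p j)| ≤ 37 / 100 * Δ := fun i j hij => by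
    have := abs_sum_le_of_sq hr (by simpa [Finset.sum_pair hij] using hmatch {i, j})
    linarith
  have hlx : ∀ i < n, ∀ j < n, |(lam i - lam j) - ρ * (x i - x j)| ≤ ρ * Δ * (1 / 45) := by
    intro i hi j hj
    have a := abs_le.1 (hclose i hi)
    have b := abs_le.1 (hclose j hj)
    rw [abs_le]
    constructor <;> nlinarith [a.1, a.2, b.1, b.2]
  -- 0.52 + 1/45 < 0.55.
  have hnear : ∀ i < n, ∀ j < n, |x i - x j| ≤ 26 / 50 * Δ →
      |lam i - lam j| ≤ ρ * Δ * (55 / 100) := by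
    intro i hi j hj h
    have a := hlx i hi j hj
    have b : |ρ * (x i - x j)| ≤ ρ * (26 / 50 * Δ) := by
      rw [abs_mul, abs_of_pos hρ]; gcongr
    have hp := mul_pos hρ hΔ
    rw [abs_le] at a b ⊢
    constructor <;> nlinarith [a.1, a.2, b.1, b.2]
  have hp := mul_pos hρ hΔ
  have hy1' := le_abs_of_matching hΔ.le hx0 hmatch hgap
  set A : Finset ℕ := (Finset.Icc 1 d).map p.symm.toEmbedding with hA
  have hmemA : ∀ i, i ∈ A ↔ p i ∈ Finset.Icc 1 d := fun i => by
    rw [hA, Finset.mem_map_equiv, Equiv.symm_symm]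
  have hAn : ∀ i ∈ A, i < n := by
    intro i hi
    by_contra hin
    have a := h1 i
    rw [hx0 i (not_lt.1 hin), hy1 _ ((hmemA i).1 hi), zero_sub, abs_neg] at a
    linarith
  have hj0n : p.symm 0 < n := by
    by_contra hin
    have a := h1 (p.symm 0)
    rw [hx0 _ (not_lt.1 hin), Equiv.apply_symm_apply, zero_sub, abs_neg] at a
    linarith [hy0 1, le_abs_self (y 0)]
  have htop : p.symm 0 ≠ 0 → |x 0 - y (p 0)| + |x (p.symm 0) - y 0| ≤ 37 / 100 * Δ ∧
      x (p.symm 0) ≤ x 0 := fun h => by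
    have a := h2 0 (p.symm 0) h.symm
    rw [Equiv.apply_symm_apply] at a
    exact ⟨a, hx _ _ (Nat.zero_le _) hj0n⟩
  -- Otherwise `x 0` is near `y 1` and `x (p.symm 0)` near `y 0` ≥ `y 1` + Δ; errors totalling 0.37Δ
  -- cannot reverse their order.
  have hA0 : 0 ∉ A := by
    intro h0
    have h0' := (hmemA 0).1 h0
    obtain ⟨a, b⟩ := htop fun h => by
      rw [Equiv.symm_apply_eq] at h
      simp [← h] at h0'
    rw [hy1 _ h0'] at a
    have c := hgap 0 (by simp)
    have e := abs_le.1 (hy0 1)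
    rw [abs_of_nonpos (by linarith)] at c
    linarith [le_abs_self (x 0 - y 1), neg_abs_le (x (p.symm 0) - y 0)]
  have hAcard : A.card = d := by simp [hA]
  have hAmem : A ∈ (Finset.Icc 1 (n - 1)).powersetCard d := by
    refine Finset.mem_powersetCard.2 ⟨fun i hi => Finset.mem_Icc.2 ?_, hAcard⟩
    have : i ≠ 0 := fun h => hA0 (h ▸ hi)
    have := hAn i hi
    omega
  have hdn : d < n := by
    have := Finset.card_le_card (Finset.mem_powersetCard.1 hAmem).1
    rw [hAcard, Nat.card_Icc] at this
    omega
  have hAgap : ρ * Δ * (55 / 100) < subsetGap lam n A := by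
    -- Two matching errors leave 1 - 0.37 = 0.63 of the gap, and passing from ρ`x` to `lam` costs
    -- 1/45 more.
    refine lt_of_lt_of_le (b := ρ * Δ * (60 / 100)) (by linarith)
      (le_subsetGap (Finset.card_pos.1 (by omega)) ⟨0, by simp [hA0]; omega⟩ ?_)
    intro i hi hiA j hj
    have hij : j ≠ i := fun h => hiA (h ▸ hj)
    have a := h2 j i hij
    rw [hy1 _ ((hmemA j).1 hj)] at a
    have b := hgap _ (fun h => hiA ((hmemA i).2 h))
    have c : 63 / 100 * Δ ≤ |x j - x i| := by
      have := abs_sub_abs_le_abs_sub (y 1 - y (p i)) ((y 1 - x j) - (y (p i) - x i))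
      have e := abs_sub (y 1 - x j) (y (p i) - x i)
      rw [abs_sub_comm (y 1) (x j), abs_sub_comm (y (p i)) (x i)] at e
      rw [show y 1 - y (p i) - (y 1 - x j - (y (p i) - x i)) = x j - x i by ring] at this
      linarith
    have e := hlx j (hAn j hj) i hi
    have f := abs_sub_abs_le_abs_sub (ρ * (x j - x i)) (lam j - lam i)
    rw [abs_sub_comm (ρ * (x j - x i)), abs_mul, abs_of_pos hρ] at f
    nlinarith [mul_le_mul_of_nonneg_left c hρ.le]
  have hinterval : ∀ S ∈ (Finset.Icc 1 (n - 1)).powersetCard d,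
      ρ * Δ * (55 / 100) < subsetGap lam n S → subsetGap lam n S ≤ windowScan lam n d := by
    intro S hS hg
    obtain ⟨hsub, hcard⟩ := Finset.mem_powersetCard.1 hS
    have hSn : ∀ i ∈ S, 1 ≤ i ∧ i < n := fun i hi => by
      have := Finset.mem_Icc.1 (hsub hi)
      omega
    have hclosed' : ∀ i ∈ S, ∀ j < n, |lam i - lam j| ≤ ρ * Δ * (55 / 100) → j ∈ S := by
      intro i hi j hj h
      by_contra hjS
      linarith [subsetGap_le (lam := lam) hj hjS hi]
    have hclosed : ∀ i ∈ S, ∀ j < n, |x i - x j| ≤ 26 / 50 * Δ → j ∈ S := fun i hi j hj h =>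
      hclosed' i hi j hj (hnear i (hSn i hi).2 j hj h)
    have hsame : ∀ i j, y (p i) = y (p j) → |x i - x j| ≤ 26 / 50 * Δ := by
      intro i j h
      rcases eq_or_ne i j with rfl | hij
      · rw [sub_self, abs_zero]; positivity
      · have a := h2 i j hij
        have b := abs_sub (x i - y (p i)) (x j - y (p j))
        rw [h, show x i - y (p j) - (x j - y (p j)) = x i - x j by ring, ← h] at b
        rw [h] at a b
        linarith
    -- The value `y 0` may be simple, so it has no block. Its partner is excluded because it would
    -- draw index 0 into `S`.
    have hj0S : p.symm 0 ∉ S := by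
      intro hj
      have hne : p.symm 0 ≠ 0 := by have := (hSn _ hj).1; omega
      obtain ⟨a, b⟩ := htop hne
      have h0 : 0 ∈ S := by
        refine hclosed _ hj 0 (by omega) ?_
        rw [abs_sub_comm, abs_of_nonneg (by linarith)]
        linarith [le_abs_self (x 0 - y (p 0)), neg_abs_le (x (p.symm 0) - y 0),
          (abs_le.1 (hy0 (p 0))).2]
      have := (hSn 0 h0).1
      omega
    have hdiam : ∀ i ∈ S, ∀ j ∈ S, |x i - x j| ≤ 26 / 50 * Δ := by
      -- Either a block represented in `S` is matched wholly below n and fills `S`, or every such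
      -- block has an index matched to the zero tail.
      by_cases hc : ∃ i ∈ S, ∃ B : Finset ℕ, d ≤ B.card ∧ (∀ b ∈ B, y b = y (p i)) ∧
          ∀ b ∈ B, p.symm b < n
      · obtain ⟨k, hk, B, hB, hBy, hBn⟩ := hc
        have hBS : B.map p.symm.toEmbedding = S := by
          refine Finset.eq_of_subset_of_card_le (fun i hi => ?_) (by simpa [hcard] using hB)
          rw [Finset.mem_map_equiv, Equiv.symm_symm] at hi
          refine hclosed k hk i (by simpa using hBn _ hi) (hsame _ _ (hBy _ hi).symm)
        have hall : ∀ i ∈ S, y (p i) = y (p k) := fun i hi => by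
          rw [← hBS, Finset.mem_map_equiv, Equiv.symm_symm] at hi
          exact hBy _ hi
        exact fun i hi j hj => hsame i j ((hall i hi).trans (hall j hj).symm)
      · push Not at hc
        have hout : ∀ i ∈ S, ∃ i', n ≤ i' ∧ y (p i') = y (p i) := by
          intro i hi
          have hpi : p i ≠ 0 := fun h => hj0S (by rwa [← h, Equiv.symm_apply_apply])
          obtain ⟨B, -, hB, hBy⟩ := hblock (p i) (by omega)
          obtain ⟨b, hb, hbn⟩ := hc i hi B hB hBy
          exact ⟨p.symm b, hbn, by rw [Equiv.apply_symm_apply, hBy b hb]⟩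
        intro i hi j hj
        obtain ⟨i', hi', hyi⟩ := hout i hi
        obtain ⟨j', hj', hyj⟩ := hout j hj
        rcases eq_or_ne i' j' with rfl | hij'
        · exact hsame i j (hyi.symm.trans hyj)
        rcases eq_or_ne i j with rfl | hij
        · exact hsame i i rfl
        have hin := (hSn i hi).2
        have hjn := (hSn j hj).2
        -- Four distinct indices: the errors at i', j' are |`y (p i)|` and |`y (p j)|`, so |`x i` -
        -- `x j`| is at most the sum of all four errors, bounded by 2 · 0.26Δ.
        have hF := hmatch {i, j, i', j'}
        rw [Finset.sum_insert (by simp; omega), Finset.sum_insert (by simp; omega),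
          Finset.sum_pair hij', hyi, hyj, hx0 i' hi', hx0 j' hj', ← add_assoc, ← add_assoc] at hF
        have a := abs_sum_four_le_of_sq hr hF
        rw [zero_sub, zero_sub, abs_neg, abs_neg] at a
        rw [abs_le]
        constructor <;> linarith [le_abs_self (x i - y (p i)), neg_abs_le (x i - y (p i)),
          le_abs_self (x j - y (p j)), neg_abs_le (x j - y (p j)), le_abs_self (y (p i)),
          neg_abs_le (y (p i)), le_abs_self (y (p j)), neg_abs_le (y (p j))]
    obtain ⟨i, hi, hin, rfl⟩ := exists_eq_Ico_of_ordConnected hd hS fun a ha c hc b hab hbc => by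
      have hcn := (hSn c hc).2
      refine hclosed' a ha b (by omega) ?_
      have e := hnear a (hSn a ha).2 c hcn (hdiam a ha c hc)
      have f := hlam a b hab (by omega)
      have g := hlam b c hbc hcn
      rw [abs_of_nonneg (by linarith)] at e ⊢
      linarith
    exact subsetGap_Ico_le_windowScan lam hd hi hin
  refine ⟨hdn, le_antisymm ?_ (windowScan_le_iSup_subsetGap hd hdn hlam)⟩
  have := hinterval A hAmem hAgap
  refine Real.iSup_le (fun S => ?_) ((subsetGap_nonneg _ _ _).trans this)
  rcases lt_or_ge (ρ * Δ * (55 / 100)) (subsetGap lam n S) with h | h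
  · exact hinterval S S.2 h
  · linarith

end Matching

/-! ### Weyl's inequalities for ordered eigenvalues -/

section Weyl

variable {E : Type*} [NormedAddCommGroup E] [InnerProductSpace ℝ E] [FiniteDimensional ℝ E]
  {T S : E →ₗ[ℝ] E} {n : ℕ}

lemma inner_apply_self_eq_sum_eigenvalues (hT : T.IsSymmetric) (hn : Module.finrank ℝ E = n)
    (x : E) : inner ℝ x (T x) =
      ∑ j, hT.eigenvalues hn j * inner ℝ (hT.eigenvectorBasis hn j) x ^ 2 := by
  rw [← (hT.eigenvectorBasis hn).sum_inner_mul_inner]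
  refine Finset.sum_congr rfl fun j _ => ?_
  rw [← hT, hT.apply_eigenvectorBasis, inner_smul_left, real_inner_comm]
  simp only [RCLike.ofReal_real_eq_id, id_eq, conj_trivial]
  ring

omit [FiniteDimensional ℝ E] in
lemma norm_sq_eq_sum_inner_sq (b : OrthonormalBasis (Fin n) ℝ E) (x : E) :
    ‖x‖ ^ 2 = ∑ j, inner ℝ (b j) x ^ 2 := by
  rw [← real_inner_self_eq_norm_sq, ← b.sum_inner_mul_inner]
  refine Finset.sum_congr rfl fun j _ => ?_
  rw [real_inner_comm, sq]

/-- **Weyl's monotonicity principle**: an affine comparison of quadratic forms gives the same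
comparison of the ordered eigenvalues. -/
theorem eigenvalues_le_of_inner_le (hT : T.IsSymmetric) (hS : S.IsSymmetric)
    (hn : Module.finrank ℝ E = n) {c t : ℝ} (hc : 0 ≤ c)
    (h : ∀ x, inner ℝ x (T x) ≤ c * inner ℝ x (S x) + t * ‖x‖ ^ 2) (i : Fin n) :
    hT.eigenvalues hn i ≤ c * hS.eigenvalues hn i + t := by
  set u := hT.eigenvectorBasis hn
  set v := hS.eigenvectorBasis hn
  -- Only n-1 linear conditions, so some nonzero x lies in both the span of u_0, …, u_i and that of
  -- v_i, …, v_{n-1}; its two quadratic forms compare the i-th eigenvalues.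
  let f : E →ₗ[ℝ] ({j : Fin n // j ≠ i} → ℝ) :=
    LinearMap.pi fun j => (innerₛₗ ℝ) (if i < j.1 then u j else v j)
  have hf : f.ker ≠ ⊥ := by
    refine LinearMap.ker_ne_bot_of_finrank_lt ?_
    have := i.pos
    rw [Module.finrank_fintype_fun_eq_card, hn, Fintype.card_subtype_compl]
    simp only [Fintype.card_fin, Fintype.card_unique]
    omega
  obtain ⟨x, hx, hx0⟩ := Submodule.exists_mem_ne_zero_of_ne_bot hf
  have hfx : ∀ j (hj : j ≠ i), inner ℝ (if i < j then u j else v j) x = 0 := fun j hj =>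
    congrFun (LinearMap.mem_ker.1 hx) ⟨j, hj⟩
  have hu : hT.eigenvalues hn i * ‖x‖ ^ 2 ≤ inner ℝ x (T x) := by
    rw [inner_apply_self_eq_sum_eigenvalues hT hn, norm_sq_eq_sum_inner_sq u, Finset.mul_sum]
    refine Finset.sum_le_sum fun j _ => ?_
    rcases lt_or_ge i j with hij | hij
    · have := hfx j hij.ne'
      rw [if_pos hij] at this
      simp [u] at this
      simp [u, this]
    · exact mul_le_mul_of_nonneg_right (hT.eigenvalues_antitone hn hij) (sq_nonneg _)
  have hv : inner ℝ x (S x) ≤ hS.eigenvalues hn i * ‖x‖ ^ 2 := by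
    rw [inner_apply_self_eq_sum_eigenvalues hS hn, norm_sq_eq_sum_inner_sq v, Finset.mul_sum]
    refine Finset.sum_le_sum fun j _ => ?_
    rcases lt_or_ge j i with hij | hij
    · have := hfx j hij.ne
      rw [if_neg hij.not_gt] at this
      simp [v] at this
      simp [v, this]
    · exact mul_le_mul_of_nonneg_right (hS.eigenvalues_antitone hn hij) (sq_nonneg _)
  have hpos : 0 < ‖x‖ ^ 2 := by positivity
  nlinarith [h x, mul_le_mul_of_nonneg_left hv hc]

end Weyl

lemma sortedSpectrum_of_le {n : ℕ} (A : Matrix (Fin n) (Fin n) ℝ) {i : ℕ} (hi : n ≤ i) :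
    sortedSpectrum A i = 0 :=
  dif_neg fun h => absurd h.2 hi.not_gt

lemma sortedSpectrum_antitone {n : ℕ} {A : Matrix (Fin n) (Fin n) ℝ} (hA : A.IsHermitian)
    (a b : ℕ) (hab : a ≤ b) (hb : b < n) : sortedSpectrum A b ≤ sortedSpectrum A a := by
  rw [sortedSpectrum, sortedSpectrum, dif_pos ⟨hA, hb⟩, dif_pos ⟨hA, hab.trans_lt hb⟩]
  exact hA.eigenvalues₀_antitone hab

open Classical in
lemma sortedSpectrum_le_of_inner_le {n : ℕ} {A B : Matrix (Fin n) (Fin n) ℝ}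
    (hA : A.IsHermitian) (hB : B.IsHermitian) {c t : ℝ} (hc : 0 ≤ c)
    (h : ∀ x, inner ℝ x (Matrix.toEuclideanLin A x) ≤
      c * inner ℝ x (Matrix.toEuclideanLin B x) + t * ‖x‖ ^ 2) {i : ℕ} (hi : i < n) :
    sortedSpectrum A i ≤ c * sortedSpectrum B i + t := by
  rw [sortedSpectrum, sortedSpectrum, dif_pos ⟨hA, hi⟩, dif_pos ⟨hB, hi⟩]
  exact eigenvalues_le_of_inner_le (Matrix.isSymmetric_toEuclideanLin_iff.mpr hA)
    (Matrix.isSymmetric_toEuclideanLin_iff.mpr hB) finrank_euclideanSpace hc (by convert h) _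

lemma abs_inner_toEuclideanLin_le {n : ℕ} (A : Matrix (Fin n) (Fin n) ℝ)
    (x : EuclideanSpace ℝ (Fin n)) :
    |inner ℝ x (Matrix.toEuclideanLin A x)| ≤ matOpNorm A * ‖x‖ ^ 2 := by
  have h1 := abs_real_inner_le_norm x (Matrix.toEuclideanLin A x)
  have h2 : ‖Matrix.toEuclideanLin A x‖ ≤ matOpNorm A * ‖x‖ :=
    (Matrix.toEuclideanCLM (n := Fin n) (𝕜 := ℝ) A).le_opNorm x
  nlinarith [norm_nonneg x]

/-- **Weyl's inequality** for a rescaled matrix. -/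
theorem abs_sortedSpectrum_sub_le {n : ℕ} {P A : Matrix (Fin n) (Fin n) ℝ}
    (hP : P.IsHermitian) (hA : A.IsHermitian) {ρ : ℝ} (hρ : 0 < ρ) {i : ℕ} (hi : i < n) :
    |sortedSpectrum A i - ρ * sortedSpectrum (ρ⁻¹ • P) i| ≤ matOpNorm (P - A) := by
  have hP' : (ρ⁻¹ • P).IsHermitian := by
    rw [Matrix.IsHermitian, Matrix.conjTranspose_smul, hP.eq, star_trivial]
  have key : ∀ x : EuclideanSpace ℝ (Fin n), |ρ * inner ℝ x (Matrix.toEuclideanLin (ρ⁻¹ • P) x) -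
      inner ℝ x (Matrix.toEuclideanLin A x)| ≤ matOpNorm (P - A) * ‖x‖ ^ 2 := fun x => by
    have := abs_inner_toEuclideanLin_le (P - A) x
    rw [map_sub, LinearMap.sub_apply, inner_sub_right] at this
    rwa [map_smul, LinearMap.smul_apply, inner_smul_right, mul_inv_cancel_left₀ hρ.ne']
  have h1 := sortedSpectrum_le_of_inner_le hA hP' (t := matOpNorm (P - A)) hρ.le
    (fun x => by have := abs_le.1 (key x); linarith) hi
  have h2 := sortedSpectrum_le_of_inner_le hP' hA (t := ρ⁻¹ * matOpNorm (P - A))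
    (inv_nonneg.2 hρ.le) (fun x => by
      have := (abs_le.1 (key x)).2
      rw [mul_assoc, ← mul_add, le_inv_mul_iff₀ hρ]
      linarith) hi
  rw [← mul_add, le_inv_mul_iff₀ hρ] at h2
  rw [abs_le]
  constructor <;> linarith

/-! ### Dimensions of the spaces of harmonic polynomials -/

lemma laplacian_apply (d : ℕ) (p : MvPolynomial (Fin d) ℝ) :
    laplacian d p = ∑ i, MvPolynomial.pderiv i (MvPolynomial.pderiv i p) := by
  simp [laplacian]

lemma isHomogeneous_laplacian {d k : ℕ} {p : MvPolynomial (Fin d) ℝ} (hp : p.IsHomogeneous k) :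
    (laplacian d p).IsHomogeneous (k - 2) := by
  rw [laplacian_apply]
  exact MvPolynomial.IsHomogeneous.sum _ _ _ fun i _ => hp.pderiv.pderiv

lemma pderiv_eq_zero_of_isHomogeneous_zero {d : ℕ} {p : MvPolynomial (Fin d) ℝ}
    (hp : p.IsHomogeneous 0) (i : Fin d) : MvPolynomial.pderiv i p = 0 := by
  rw [← MvPolynomial.totalDegree_zero_iff_isHomogeneous,
    MvPolynomial.totalDegree_eq_zero_iff_eq_C] at hp
  rw [hp, MvPolynomial.pderiv_C]

lemma harmonicSpace_eq_homogeneousSubmodule (d : ℕ) {k : ℕ} (hk : k ≤ 1) :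
    harmonicSpace d k = MvPolynomial.homogeneousSubmodule (Fin d) ℝ k := by
  refine inf_eq_left.2 fun p hp => ?_
  rw [LinearMap.mem_ker, laplacian_apply]
  refine Finset.sum_eq_zero fun i _ => pderiv_eq_zero_of_isHomogeneous_zero ?_ i
  have : (MvPolynomial.pderiv i p).IsHomogeneous (k - 1) :=
    MvPolynomial.IsHomogeneous.pderiv ((MvPolynomial.mem_homogeneousSubmodule _ _).1 hp)
  rwa [Nat.sub_eq_zero_of_le hk] at this

lemma harmonicDim_zero (d : ℕ) : harmonicDim d 0 = 1 := by
  rw [harmonicDim, harmonicSpace_eq_homogeneousSubmodule d zero_le_one,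
    MvPolynomial.homogeneousSubmodule_zero, Submodule.one_eq_span]
  exact finrank_span_singleton one_ne_zero

lemma harmonicDim_one (d : ℕ) : harmonicDim d 1 = d := by
  rw [harmonicDim, harmonicSpace_eq_homogeneousSubmodule d le_rfl,
    MvPolynomial.homogeneousSubmodule_one_eq_span_X,
    finrank_span_eq_card (MvPolynomial.linearIndependent_X (Fin d) ℝ), Fintype.card_fin]

lemma finrank_homogeneousSubmodule (d k : ℕ) :
    Module.finrank ℝ (MvPolynomial.homogeneousSubmodule (Fin d) ℝ k) =
      Nat.card {m : Fin d →₀ ℕ // m.degree = k} := by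
  rw [MvPolynomial.homogeneousSubmodule_eq_finsupp_supported]
  exact Module.finrank_eq_nat_card_basis
    (MvPolynomial.basisRestrictSupport ℝ {m : Fin d →₀ ℕ | m.degree = k})

/-- Multiplication by the square of the first variable misses at least `d` monomials of
degree `k`. -/
lemma card_degree_add_le {d k : ℕ} (hd : 2 ≤ d) (hk : 2 ≤ k) :
    Nat.card {m : Fin d →₀ ℕ // m.degree = k - 2} + d ≤
      Nat.card {m : Fin d →₀ ℕ // m.degree = k} := by
  let o : Fin d := ⟨0, by omega⟩
  let o' : Fin d := ⟨1, by omega⟩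
  have ho : o' ≠ o := by simp [o, o']
  let f : {m : Fin d →₀ ℕ // m.degree = k - 2} ⊕ Fin d → {m : Fin d →₀ ℕ // m.degree = k} :=
    Sum.elim (fun m => ⟨m.1 + Finsupp.single o 2, by
        rw [map_add, m.2, Finsupp.degree_single]; omega⟩)
      -- These d extra monomials have exponent 0 or 1 in the variable `o`, so none is divisible by
      -- its square.
      (fun j => ⟨if j = o then Finsupp.single o' k else
        Finsupp.single o 1 + Finsupp.single j (k - 1), by
        split_ifs
        · rw [Finsupp.degree_single]
        · rw [map_add, Finsupp.degree_single, Finsupp.degree_single]; omega⟩)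
  have hf : Function.Injective f := by
    have hlr : ∀ m j, f (Sum.inl m) ≠ f (Sum.inr j) := fun m j h => by
      have := DFunLike.congr_fun (Subtype.ext_iff.1 h) o
      by_cases hj : j = o
      · simp [f, hj, Finsupp.single_eq_of_ne' ho] at this
      · simp [f, hj, Finsupp.single_eq_of_ne' hj] at this
    rintro (m | i) (m' | j) h
    · simpa [f, Subtype.ext_iff] using h
    · exact absurd h (hlr m j)
    · exact absurd h.symm (hlr m' i)
    · have h0 := DFunLike.congr_fun (Subtype.ext_iff.1 h) o
      have h1 := DFunLike.congr_fun (Subtype.ext_iff.1 h) i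
      by_cases hi : i = o <;> by_cases hj : j = o
      · rw [hi, hj]
      · simp [f, hi, hj, Finsupp.single_eq_of_ne' ho, Finsupp.single_eq_of_ne' hj] at h0
      · simp [f, hi, hj, Finsupp.single_eq_of_ne' ho, Finsupp.single_eq_of_ne' hi] at h0
      · by_contra hij
        have hij' : j ≠ i := fun e => hij (congrArg _ e.symm)
        simp [f, hi, hj, Finsupp.single_eq_of_ne' hij'] at h1
        omega
  have hfin : ∀ k, Finite {m : Fin d →₀ ℕ // m.degree = k} := fun k =>
    (Finsupp.finite_of_degree_eq k).to_subtype
  have := hfin k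
  have := hfin (k - 2)
  have h := Nat.card_le_card_of_injective f hf
  rwa [Nat.card_sum, Nat.card_fin] at h

lemma le_harmonicDim {d k : ℕ} (hd : 2 ≤ d) (hk : 1 ≤ k) : d ≤ harmonicDim d k := by
  rcases hk.eq_or_lt with rfl | hk
  · exact (harmonicDim_one d).ge
  have hfd : ∀ k, FiniteDimensional ℝ (MvPolynomial.homogeneousSubmodule (Fin d) ℝ k) := fun k =>
    Module.Finite.iff_fg.2 (MvPolynomial.homogeneousSubmodule_fg _ _ k)
  have := hfd k
  have := hfd (k - 2)
  let L := (laplacian d).domRestrict (MvPolynomial.homogeneousSubmodule (Fin d) ℝ k)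
  -- Rank–nullity bounds the kernel below by the difference of the two monomial counts; surjectivity
  -- of the Laplacian is not needed.
  have h1 := L.finrank_range_add_finrank_ker
  have h2 : Module.finrank ℝ L.range ≤
      Module.finrank ℝ (MvPolynomial.homogeneousSubmodule (Fin d) ℝ (k - 2)) := by
    refine Submodule.finrank_mono ?_
    rintro _ ⟨p, rfl⟩
    exact isHomogeneous_laplacian p.2
  have h3 : Module.finrank ℝ L.ker = harmonicDim d k := by
    have : L.ker.map (Submodule.subtype _) = harmonicSpace d k := by
      ext p
      simp [L, harmonicSpace, and_comm]
    rw [← Submodule.finrank_map_subtype_eq, harmonicDim, this]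
  rw [finrank_homogeneousSubmodule] at h1 h2
  have := card_degree_add_le hd hk
  omega

/-! ### Enumeration of the graphon spectrum by degree -/

lemma harmonicDegree_eq {d k j : ℕ} (h1 : ∑ l ∈ Finset.range k, harmonicDim d l ≤ j)
    (h2 : j < ∑ l ∈ Finset.range (k + 1), harmonicDim d l) : harmonicDegree d j = k := by
  refine le_antisymm (Nat.sInf_le h2) (le_csInf ⟨k, h2⟩ fun m hm => ?_)
  by_contra! hmk
  have : ∑ l ∈ Finset.range (m + 1), harmonicDim d l ≤ ∑ l ∈ Finset.range k, harmonicDim d l :=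
    Finset.sum_le_sum_of_subset (Finset.range_mono hmk)
  exact absurd (hm.trans_le this) h1.not_gt

lemma harmonicDegree_spec {d : ℕ} (hd : 2 ≤ d) (j : ℕ) :
    ∑ l ∈ Finset.range (harmonicDegree d j), harmonicDim d l ≤ j ∧
      j < ∑ l ∈ Finset.range (harmonicDegree d j + 1), harmonicDim d l := by
  have hne : {k : ℕ | j < ∑ l ∈ Finset.range (k + 1), harmonicDim d l}.Nonempty := by
    refine ⟨j, ?_⟩
    have : ∑ l ∈ Finset.range (j + 1), 1 ≤ ∑ l ∈ Finset.range (j + 1), harmonicDim d l := by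
      refine Finset.sum_le_sum fun l _ => ?_
      rcases Nat.eq_zero_or_pos l with rfl | hl
      · exact (harmonicDim_zero d).ge
      · exact (le_harmonicDim hd hl).trans' (by omega)
    simpa using this
  refine ⟨?_, Nat.sInf_mem hne⟩
  rcases h : harmonicDegree d j with _ | k
  · simp
  · exact not_lt.1 (Nat.notMem_of_lt_sInf
      (s := {k : ℕ | j < ∑ l ∈ Finset.range (k + 1), harmonicDim d l}) (h.symm ▸ Nat.lt_succ_self k : k < harmonicDegree d j))

lemma harmonicDegree_zero (d : ℕ) : harmonicDegree d 0 = 0 :=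
  harmonicDegree_eq (by simp) (by simp [harmonicDim_zero])

lemma harmonicDegree_eq_one {d j : ℕ} (hj : j ∈ Finset.Icc 1 d) : harmonicDegree d j = 1 := by
  rw [Finset.mem_Icc] at hj
  refine harmonicDegree_eq ?_ ?_
  · simpa [harmonicDim_zero] using hj.1
  · simp only [Finset.sum_range_succ, Finset.sum_range_zero, harmonicDim_zero, harmonicDim_one]
    omega

lemma graphonSpectrum_block {d : ℕ} (hd : 2 ≤ d) (W : SphereGraphon d) {j : ℕ} (hj : 1 ≤ j) :
    ∃ B : Finset ℕ, j ∈ B ∧ d ≤ B.card ∧ ∀ b ∈ B, graphonSpectrum W b = graphonSpectrum W j := by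
  obtain ⟨h1, h2⟩ := harmonicDegree_spec hd j
  set k := harmonicDegree d j with hk
  have hk1 : 1 ≤ k := by
    by_contra hk0
    rw [show k = 0 by omega] at h2
    simp [harmonicDim_zero] at h2
    omega
  refine ⟨Finset.Ico (∑ l ∈ Finset.range k, harmonicDim d l)
    (∑ l ∈ Finset.range (k + 1), harmonicDim d l), Finset.mem_Ico.2 ⟨h1, h2⟩, ?_, fun b hb => ?_⟩
  · rw [Nat.card_Ico, Finset.sum_range_succ, Nat.add_sub_cancel_left]
    exact le_harmonicDim hd hk1
  · rw [Finset.mem_Ico] at hb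
    rw [graphonSpectrum, graphonSpectrum, harmonicDegree_eq hb.1 hb.2, ← hk]

/-! ### Rotation invariance and constant degree function -/

section Sigma

variable {d : ℕ}

lemma nontrivial_euclideanSpace (hd : 2 ≤ d) : Nontrivial (EuclideanSpace ℝ (Fin d)) := by
  have : Nonempty (Fin d) := ⟨⟨0, by omega⟩⟩
  infer_instance

lemma isProbabilityMeasure_sigma (hd : 2 ≤ d) : IsProbabilityMeasure (sigma d) := by
  have := nontrivial_euclideanSpace hd
  refine ⟨?_⟩
  rw [sigma, Measure.smul_apply, smul_eq_mul]
  exact ENNReal.inv_mul_cancel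
    (Measure.measure_univ_ne_zero.2 (Measure.toSphere_ne_zero _)) (measure_ne_top _ _)

lemma isOpenPosMeasure_sigma (d : ℕ) : (sigma d).IsOpenPosMeasure :=
  Measure.isOpenPosMeasure_smul _ (ENNReal.inv_ne_zero.2 (measure_ne_top _ _))

/-- The action of a linear isometry on the sphere. -/
noncomputable def sphereMap (R : EuclideanSpace ℝ (Fin d) ≃ₗᵢ[ℝ] EuclideanSpace ℝ (Fin d)) (x : Sph d) : Sph d :=
  ⟨R x, by simp⟩

lemma continuous_sphereMap (R : EuclideanSpace ℝ (Fin d) ≃ₗᵢ[ℝ] EuclideanSpace ℝ (Fin d)) :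
    Continuous (sphereMap R) :=
  (R.continuous.comp continuous_subtype_val).subtype_mk _

open scoped Pointwise in
lemma measurePreserving_sphereMap
    (R : EuclideanSpace ℝ (Fin d) ≃ₗᵢ[ℝ] EuclideanSpace ℝ (Fin d)) :
    MeasurePreserving (sphereMap R) (sigma d) (sigma d) := by
  have hm := (continuous_sphereMap R).measurable
  refine ⟨hm, ?_⟩
  rw [sigma, Measure.map_smul]
  congr 1
  ext s hs
  rw [Measure.map_apply hm hs, Measure.toSphere_apply' _ (hm hs), Measure.toSphere_apply' _ hs]
  congr 1
  -- Surface measure is a multiple of the volume of the cone over a set, and `R` preserves volume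
  -- and commutes with forming cones.
  rw [← R.measurePreserving.measure_preimage_emb R.toHomeomorph.measurableEmbedding
    (Set.Ioo (0 : ℝ) 1 • (Subtype.val '' s))]
  congr 1
  ext v
  simp only [Set.mem_smul, Set.mem_image, Set.mem_preimage, exists_exists_and_eq_and]
  constructor
  · rintro ⟨r, hr, x, hx, rfl⟩
    exact ⟨r, hr, sphereMap R x, hx, by simp [sphereMap]⟩
  · rintro ⟨r, hr, y, hy, h⟩
    refine ⟨r, hr, sphereMap R.symm y, ?_, ?_⟩
    · convert hy
      ext1
      simp [sphereMap]
    · apply R.injective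
      rw [← h]
      simp [sphereMap]

/-- The reflection in the hyperplane orthogonal to x - y swaps two vectors of equal norm. -/
lemma exists_sphereMap_eq (x y : Sph d) : ∃ R, sphereMap R x = y :=
  ⟨Submodule.reflection (Submodule.span ℝ {(x : EuclideanSpace ℝ (Fin d)) - y})ᗮ,
    Subtype.ext (Submodule.reflection_sub (by simp))⟩

end Sigma

namespace SphereGraphon

variable {d : ℕ} (W : SphereGraphon d)

lemma measurable_section (x : Sph d) : Measurable (W.toFun x) :=
  W.measurable_uncurry.comp measurable_prodMk_left

lemma integrable_section (hd : 2 ≤ d) (x : Sph d) : Integrable (W.toFun x) (sigma d) := by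
  have := isProbabilityMeasure_sigma hd
  refine Integrable.of_bound (W.measurable_section x).aestronglyMeasurable 1 (ae_of_all _ fun y => ?_)
  rw [Real.norm_eq_abs, abs_of_nonneg (W.mem_Icc x y).1]
  exact (W.mem_Icc x y).2

/-- The degree function of a geometric graphon is constant. -/
lemma integral_section_eq {W : SphereGraphon d} (hW : W.IsGeometric) (x y : Sph d) :
    ∫ z, W.toFun x z ∂(sigma d) = ∫ z, W.toFun y z ∂(sigma d) := by
  obtain ⟨R, rfl⟩ := exists_sphereMap_eq x y
  obtain ⟨f, -, hf⟩ := hW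
  have h := measurePreserving_sphereMap R
  conv_rhs => rw [← h.map_eq, integral_map h.measurable.aemeasurable
    (W.measurable_section _).aestronglyMeasurable]
  refine integral_congr_ae (ae_of_all _ fun z => ?_)
  simp only [hf]
  simp [sphereMap]

end SphereGraphon

/-! ### The constants carry the largest eigenvalue -/

section Harmonic

variable {d : ℕ} {W : SphereGraphon d}

lemma harmonicEigenvalue_spec {k : ℕ} (h : ∃ μ, IsHarmonicEigenvalue W k μ) :
    IsHarmonicEigenvalue W k (harmonicEigenvalue W k) := by
  rw [harmonicEigenvalue, dif_pos h]
  exact h.choose_spec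

lemma isHarmonicEigenvalue_zero (hW : W.IsGeometric) (x₀ : Sph d) :
    IsHarmonicEigenvalue W 0 (∫ y, W.toFun x₀ y ∂(sigma d)) := by
  intro Y hY
  have hY0 : Y.IsHomogeneous 0 := hY.1
  rw [← MvPolynomial.totalDegree_zero_iff_isHomogeneous,
    MvPolynomial.totalDegree_eq_zero_iff_eq_C] at hY0
  refine ae_of_all _ fun x => ?_
  simp only [integralOp, restrictSph]
  rw [hY0]
  simp only [MvPolynomial.eval_C]
  rw [integral_const_mul, mul_comm, SphereGraphon.integral_section_eq hW x x₀]

lemma harmonicEigenvalue_zero_eq (hd : 2 ≤ d) (hW : W.IsGeometric) (x : Sph d) :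
    harmonicEigenvalue W 0 = ∫ y, W.toFun x y ∂(sigma d) := by
  have := isProbabilityMeasure_sigma hd
  have h := harmonicEigenvalue_spec ⟨_, isHarmonicEigenvalue_zero hW x⟩ 1
    (by rw [harmonicSpace_eq_homogeneousSubmodule d zero_le_one]
        exact MvPolynomial.isHomogeneous_one _ _)
  obtain ⟨z, hz⟩ := h.exists
  simp only [integralOp, restrictSph, map_one, one_mul, mul_one] at hz
  rw [← hz, SphereGraphon.integral_section_eq hW]

lemma nonempty_sph (hd : 2 ≤ d) : Nonempty (Sph d) := by
  have := nontrivial_euclideanSpace hd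
  exact (NormedSpace.sphere_nonempty.2 zero_le_one).to_subtype

lemma harmonicEigenvalue_zero_mem_Icc (hd : 2 ≤ d) (hW : W.IsGeometric) :
    harmonicEigenvalue W 0 ∈ Set.Icc (0 : ℝ) 1 := by
  have := isProbabilityMeasure_sigma hd
  obtain ⟨x⟩ := nonempty_sph hd
  rw [harmonicEigenvalue_zero_eq hd hW x]
  refine ⟨integral_nonneg fun y => (W.mem_Icc x y).1, ?_⟩
  have := integral_mono (W.integrable_section hd x) (integrable_const (1 : ℝ))
    fun y => (W.mem_Icc x y).2
  simpa using this

lemma continuous_restrictSph (Y : MvPolynomial (Fin d) ℝ) : Continuous (restrictSph Y) := by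
  unfold restrictSph
  exact (MvPolynomial.continuous_eval Y).comp (by fun_prop)

/-- A homogeneous polynomial that vanishes on the sphere is zero. -/
lemma eq_zero_of_restrictSph_eq_zero (hd : 2 ≤ d) {k : ℕ} {Y : MvPolynomial (Fin d) ℝ}
    (hY : Y.IsHomogeneous k) (h : ∀ x, restrictSph Y x = 0) : Y = 0 := by
  have key : ∀ v : EuclideanSpace ℝ (Fin d), v ≠ 0 → MvPolynomial.eval (fun i => v i) Y = 0 := by
    intro v hv
    have hn : ‖v‖ ≠ 0 := norm_ne_zero_iff.2 hv
    have h1 := h ⟨‖v‖⁻¹ • v, by simp [norm_smul, hn]⟩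
    have h2 : restrictSph Y ⟨‖v‖⁻¹ • v, by simp [norm_smul, hn]⟩ =
        ‖v‖⁻¹ ^ k * MvPolynomial.eval (fun i => v i) Y := by
      simp only [restrictSph, PiLp.smul_apply, smul_eq_mul]
      rw [MvPolynomial.eval_eq', MvPolynomial.eval_eq', Finset.mul_sum]
      refine Finset.sum_congr rfl fun m hm => ?_
      have hm' : ∑ i, m i = k := by
        rw [← Finsupp.degree_eq_sum, Finsupp.degree_eq_weight_one]
        exact hY (MvPolynomial.mem_support_iff.1 hm)
      simp_rw [mul_pow]
      rw [Finset.prod_mul_distrib, Finset.prod_pow_eq_pow_sum, hm']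
      ring
    rw [h1, eq_comm] at h2
    exact (mul_eq_zero.1 h2).resolve_left (by positivity)
  let o : Fin d := ⟨0, by omega⟩
  -- Scaling gives nothing at the origin; the factor `X o` makes the product vanish there too.
  have hX : MvPolynomial.X o * Y = 0 := by
    refine MvPolynomial.funext fun v => ?_
    rw [map_mul, MvPolynomial.eval_X, map_zero]
    rcases eq_or_ne v 0 with rfl | hv
    · rw [Pi.zero_apply, zero_mul]
    · rw [show MvPolynomial.eval v Y = 0 from key (WithLp.toLp 2 v) (by simpa using hv), mul_zero]
  exact (mul_eq_zero.1 hX).resolve_left (MvPolynomial.X_ne_zero o)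

/-- A maximum principle: since `W` ≥ 0, |T_W Y| is at most max |Y| times the constant degree, which
is the eigenvalue of degree 0. Evaluate at a maximiser of |Y|. -/
lemma abs_harmonicEigenvalue_le (hd : 2 ≤ d) (hW : W.IsGeometric) {k : ℕ}
    (hk : harmonicDim d k ≠ 0) : |harmonicEigenvalue W k| ≤ harmonicEigenvalue W 0 := by
  by_cases hex : ∃ μ, IsHarmonicEigenvalue W k μ
  swap
  · rw [harmonicEigenvalue, dif_neg hex, abs_zero]
    exact (harmonicEigenvalue_zero_mem_Icc hd hW).1
  have := isProbabilityMeasure_sigma hd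
  have := isOpenPosMeasure_sigma d
  have := nonempty_sph hd
  obtain ⟨Y, hYmem, hY0⟩ : ∃ Y ∈ harmonicSpace d k, Y ≠ 0 := by
    refine Submodule.exists_mem_ne_zero_of_ne_bot fun h => hk ?_
    rw [harmonicDim, h, finrank_bot]
  have hcont := (continuous_restrictSph Y).abs
  obtain ⟨z, -, hz⟩ := isCompact_univ.exists_isMaxOn Set.univ_nonempty hcont.continuousOn
  have hz' : ∀ x, |restrictSph Y x| ≤ |restrictSph Y z| := fun x => hz (Set.mem_univ x)
  have hpos : 0 < |restrictSph Y z| := by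
    by_contra! h0
    exact hY0 (eq_zero_of_restrictSph_eq_zero hd hYmem.1 fun x =>
      abs_nonpos_iff.1 ((hz' x).trans h0))
  set F : Set (Sph d) := {x | |harmonicEigenvalue W k| * |restrictSph Y x| ≤
    harmonicEigenvalue W 0 * |restrictSph Y z|} with hF
  have hFclosed : IsClosed F := isClosed_le (continuous_const.mul hcont) continuous_const
  -- The eigenvalue equation holds only almost everywhere; a closed set of full measure is
  -- everything, as `sigma` charges open sets.
  have hFuniv : F = Set.univ := by
    rw [← hFclosed.ae_eq_univ_iff_eq (μ := sigma d), Filter.eventuallyEq_univ]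
    filter_upwards [harmonicEigenvalue_spec hex Y hYmem] with x hx
    have hint := (W.integrable_section hd x).const_mul |restrictSph Y z|
    rw [hF, Set.mem_ofPred_eq, ← abs_mul, ← hx, harmonicEigenvalue_zero_eq hd hW x, mul_comm,
      ← integral_const_mul, ← Real.norm_eq_abs]
    refine norm_integral_le_of_norm_le hint (ae_of_all _ fun y => ?_)
    rw [Real.norm_eq_abs, abs_mul, abs_of_nonneg (W.mem_Icc x y).1]
    exact mul_le_mul_of_nonneg_right (hz' y) (W.mem_Icc x y).1
  have hzF : z ∈ F := hFuniv ▸ Set.mem_univ z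
  exact le_of_mul_le_mul_right hzF hpos

end Harmonic

/-! ### From the event to the hypotheses of the perturbation result -/

lemma exists_matching_of_deltaTwo_lt {x y : ℕ → ℝ} {r : ℝ} (hr : 0 ≤ r)
    (h : deltaTwo x y < ENNReal.ofReal r) :
    ∃ p : Equiv.Perm ℕ, ∀ F : Finset ℕ, ∑ i ∈ F, (x i - y (p i)) ^ 2 ≤ r ^ 2 := by
  obtain ⟨p, hp⟩ := iInf_lt_iff.1 h
  refine ⟨p, fun F => ?_⟩
  have h1 : ∑' i, ENNReal.ofReal ((x i - y (p i)) ^ 2) ≤ ENNReal.ofReal (r ^ 2) := by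
    have := ENNReal.rpow_le_rpow hp.le (zero_le_two (α := ℝ))
    rw [← ENNReal.rpow_mul] at this
    norm_num at this
    rwa [← ENNReal.ofReal_pow hr] at this
  have h2 := (ENNReal.sum_le_tsum F).trans h1
  rw [← ENNReal.ofReal_sum_of_nonneg fun i _ => sq_nonneg _] at h2
  exact (ENNReal.ofReal_le_ofReal_iff (sq_nonneg r)).1 h2

lemma isHermitian_probMatrix {d n : ℕ} (W : SphereGraphon d) (ρ : ℝ) (X : Fin n → Sph d) :
    (probMatrix W ρ X).IsHermitian :=
  Matrix.IsHermitian.ext fun i j => by simp [probMatrix, W.symmetric (X i) (X j)]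

lemma abs_graphonSpectrum_le {d : ℕ} (hd : 2 ≤ d) {W : SphereGraphon d} (hW : W.IsGeometric)
    (j : ℕ) : |graphonSpectrum W j| ≤ graphonSpectrum W 0 := by
  rw [graphonSpectrum, graphonSpectrum, harmonicDegree_zero]
  refine abs_harmonicEigenvalue_le hd hW fun h => ?_
  have := harmonicDegree_spec hd j
  rw [Finset.sum_range_succ, h] at this
  omega

lemma graphonGap_le {d : ℕ} (W : SphereGraphon d) {j : ℕ} (hj : j ∉ Finset.Icc 1 d) :
    graphonGap W ≤ |graphonSpectrum W 1 - graphonSpectrum W j| := by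
  refine ciInf_le ⟨0, ?_⟩
    (⟨j, by rwa [harmonicDim_one]⟩ : {j : ℕ // j ∉ Finset.Icc 1 (harmonicDim d 1)})
  rintro _ ⟨i, rfl⟩
  exact abs_nonneg _

end HEiC

theorem mainTheorem3 (d : ℕ) (hd : 2 ≤ d)
    (W : HEiC.SphereGraphon d) (hW : W.IsGeometric) (hgap : 0 < HEiC.graphonGap W)
    (n : ℕ) (ρ : ℝ) (hρ0 : 0 < ρ) (hρ1 : ρ ≤ 1) :
    ∀ ω ∈ HEiC.goodEvent W n ρ,
      d < n ∧ HEiC.empiricalGap d ω.That = HEiC.windowGap d ω.That := by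
  rintro ω ⟨hδ, hop⟩
  set Δ := HEiC.graphonGap W with hΔ
  have hThat : ω.That.IsHermitian := by
    rw [Matrix.IsHermitian, Matrix.conjTranspose_eq_transpose_of_trivial, ω.symm.eq]
  have hP := HEiC.isHermitian_probMatrix W ρ ω.X
  have hρP : (ρ⁻¹ • HEiC.probMatrix W ρ ω.X).IsHermitian := by
    rw [Matrix.IsHermitian, Matrix.conjTranspose_smul, hP.eq, star_trivial]
  -- The infimum over permutations need not be attained, so 1/4 is relaxed to 13/50.
  obtain ⟨p, hp⟩ := HEiC.exists_matching_of_deltaTwo_lt (r := 13 / 50 * Δ) (by positivity)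
    (hδ.trans_lt ((ENNReal.ofReal_lt_ofReal_iff (by positivity)).2 (by linarith)))
  have hy1 : ∀ j ∈ Finset.Icc 1 d, HEiC.graphonSpectrum W j = HEiC.graphonSpectrum W 1 := by
    intro j hj
    have h1 : (1 : ℕ) ∈ Finset.Icc 1 d := by simp; omega
    rw [HEiC.graphonSpectrum, HEiC.graphonSpectrum, HEiC.harmonicDegree_eq_one hj,
      HEiC.harmonicDegree_eq_one h1]
  have hy0 := HEiC.abs_graphonSpectrum_le hd hW
  have hy01 : HEiC.graphonSpectrum W 0 ≤ 1 := by
    rw [HEiC.graphonSpectrum, HEiC.harmonicDegree_zero]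
    exact (HEiC.harmonicEigenvalue_zero_mem_Icc hd hW).2
  have hΔ2 := HEiC.le_abs_of_matching hgap.le (fun i hi => HEiC.sortedSpectrum_of_le _ hi) hp
    fun j hj => HEiC.graphonGap_le W hj
  have hΔ3 : Δ ≤ 50 / 37 := by linarith [hy0 1]
  -- As 2^{9/2}√d ≥ 32, the event gives at most ρΔ²/128; one factor Δ ≤ 50/37 turns this into less
  -- than ρΔ/90.
  have hop' : HEiC.matOpNorm (HEiC.probMatrix W ρ ω.X - ω.That) ≤ ρ * (Δ / 90) := by
    have h32 : (32 : ℝ) ≤ 2 ^ (9 / 2 : ℝ) * √(d : ℝ) := by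
      have h2 : √2 ≤ √(d : ℝ) := Real.sqrt_le_sqrt (by exact_mod_cast hd)
      calc (32 : ℝ) = 2 ^ (9 / 2 : ℝ) * √2 := by
            rw [Real.sqrt_eq_rpow, ← Real.rpow_add two_pos]
            norm_num
        _ ≤ _ := by gcongr
    rw [div_mul_eq_mul_div, div_le_iff₀ (mul_pos hρ0 hgap)] at hop
    have hM : 0 ≤ HEiC.matOpNorm (HEiC.probMatrix W ρ ω.X - ω.That) := norm_nonneg _
    nlinarith [mul_le_mul_of_nonneg_right h32 hM,
      mul_le_mul_of_nonneg_left hΔ3 (mul_pos hρ0 hgap).le, mul_pos hρ0 hgap]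
  exact HEiC.iSup_subsetGap_eq_windowScan (by omega) hgap hρ0
    (fun i hi => HEiC.sortedSpectrum_of_le _ hi) (HEiC.sortedSpectrum_antitone hρP)
    (HEiC.sortedSpectrum_antitone hThat)
    (fun i hi => (HEiC.abs_sortedSpectrum_sub_le hP hThat hρ0 hi).trans hop')
    hp hy1 (fun j hj => HEiC.graphonGap_le W hj) hy0 fun j hj => HEiC.graphonSpectrum_block hd W hj
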